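/- Let $G$ be a finite directed graph (without parallel edges) that is an upward outerplanar cactus, i.e. the underlying undirected graph of $G$ is connected, any two different simple cycles of it have at most one vertex in common, and $G$ has a planar drawing in which all vertices lie on the boundary of the outer face and every directed edge $uv$ is drawn as a curve from $u$ to $v$ along which the $y$-coordinate strictly increases. Then $G$ admits a $6$-page upward book embedding: with $n = |V|$, there are a bijection $\pi\colon V\to\{1,\dots,n\}$ with $\pi(u)<\pi(v)$ for every edge $uv$ directed from $u$ to $v$, and an assignment $\sigma\colon E\to\{1,\dots,6\}$ of the edges to pages, such that no two edges $uv, wx$ with $\sigma(uv)=\sigma(wx)$ satisfy $\pi(u)<\pi(w)<\pi(v)<\pi(x)$. Moreover, $\pi$ and $\sigma$ can be chosen such that, for every block (maximal connected subgraph without a cut-vertex of its own) of the underlying graph, $\sigma$ assigns the edges of that block to at most two pages. -/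

import Mathlib

namespace Digraph

variable {V : Type*}

/-- The edges of a digraph: the pair `(u, v)` is the edge directed from its tail `u`
to its head `v`. -/
abbrev Edge (G : Digraph V) : Type _ := {e : V × V // G.Adj e.1 e.2}

/-- The tail of an edge. -/
abbrev Edge.tail {G : Digraph V} (e : G.Edge) : V := e.1.1

/-- The head of an edge. -/
abbrev Edge.head {G : Digraph V} (e : G.Edge) : V := e.1.2

/-- A planar drawing of a digraph: vertices are distinct points of the plane, every edge is a
simple curve from its tail to its head, a curve contains no vertex besides its end-vertices,
and two different curves meet only at common end-vertices. -/
structure PlanarDrawing (G : Digraph V) where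
  /-- The point that represents a vertex. -/
  pos : V → ℝ × ℝ
  /-- The curve that represents an edge. -/
  curve : ∀ e : G.Edge, Path (pos e.tail) (pos e.head)
  pos_injective : Function.Injective pos
  curve_injective : ∀ e : G.Edge, Function.Injective (curve e)
  eq_of_curve_eq_pos : ∀ (e : G.Edge) (t : unitInterval) (w : V),
    curve e t = pos w → w = e.tail ∨ w = e.head
  not_cross : ∀ (e f : G.Edge) (s t : unitInterval), e ≠ f → curve e s = curve f t →
    ∃ w : V, (w = e.tail ∨ w = e.head) ∧ (w = f.tail ∨ w = f.head) ∧ curve e s = pos w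

namespace PlanarDrawing

variable {G : Digraph V}

/-- The set of all points covered by the vertices and edges of a drawing. -/
def support (D : G.PlanarDrawing) : Set (ℝ × ℝ) :=
  Set.range D.pos ∪ ⋃ e : G.Edge, Set.range (D.curve e)

/-- The outer face: the points of the complement of the drawing that lie in an unbounded
connected component of that complement. -/
def outerFace (D : G.PlanarDrawing) : Set (ℝ × ℝ) :=
  {p | p ∈ D.supportᶜ ∧ ¬ Bornology.IsBounded (connectedComponentIn D.supportᶜ p)}

/-- All vertices are on (the boundary of) the outer face. -/
def IsOuterplanar (D : G.PlanarDrawing) : Prop :=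
  ∀ v : V, D.pos v ∈ closure D.outerFace

/-- Every edge is drawn as a `y`-monotone curve going up from its tail to its head. -/
def IsUpward (D : G.PlanarDrawing) : Prop :=
  ∀ e : G.Edge, StrictMono fun t : unitInterval => (D.curve e t).2

end PlanarDrawing

/-- A digraph is upward outerplanar if it has a planar drawing that is both outerplanar
and upward. -/
def IsUpwardOuterplanar (G : Digraph V) : Prop :=
  ∃ D : G.PlanarDrawing, D.IsOuterplanar ∧ D.IsUpward

/-- A `k`-page upward book embedding of a digraph on `n` vertices: a bijection from the vertices
to `n` consecutive positions that places the tail of every edge before its head, and an assignment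
of the edges to `k` pages such that no two edges on the same page have interleaving
end-vertices. -/
structure UpwardBookEmbedding [Fintype V] (G : Digraph V) (k : ℕ) where
  /-- The vertex order. -/
  order : V ≃ Fin (Fintype.card V)
  /-- The page assignment. -/
  page : G.Edge → Fin k
  upward : ∀ e : G.Edge, order e.tail < order e.head
  not_cross : ∀ e f : G.Edge, page e = page f →
    ¬ (order e.tail < order f.tail ∧ order f.tail < order e.head ∧ order e.head < order f.head)

end Digraph

namespace SimpleGraph

variable {V : Type*}

/-- A cactus: a connected graph in which any two different simple cycles have at most one vertex
in common. (Such a graph is automatically outerplanar.) -/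
def IsCactus (G : SimpleGraph V) : Prop :=
  G.Connected ∧ ∀ (u v : V) (p : G.Walk u u) (q : G.Walk v v), p.IsCycle → q.IsCycle →
    p.toSubgraph ≠ q.toSubgraph → (p.toSubgraph.verts ∩ q.toSubgraph.verts).Subsingleton

/-- A subgraph that is connected and stays connected when any one of its vertices is deleted
(a single vertex and a single edge are included). -/
def Subgraph.IsNonseparable {G : SimpleGraph V} (H : G.Subgraph) : Prop :=
  H.Connected ∧ ∀ v ∈ H.verts, (H.deleteVerts {v}).Preconnected

/-- A block: a maximal subgraph that is connected and has no cut-vertex of its own. -/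
def Subgraph.IsBlock {G : SimpleGraph V} (H : G.Subgraph) : Prop :=
  Maximal Subgraph.IsNonseparable H

end SimpleGraph

/-! Heights in the upward drawing increase along every edge, so the digraph is acyclic. The vertex
set is exhausted by growing a set `S` such that each component of the rest is adjacent to at most
one vertex of `S` (`SingleAttachment`). Let `v ∈ S` have a neighbour `u` outside. If `u` is the only
neighbour of `v` in its component, `u` alone is added; otherwise there is a second neighbour `u'`,
and a whole path from `u` to `u'` is added, which closes a cycle through `v`. The cactus property,
in the form `IsCactus.not_three_neighbors`, makes such a path induced and preserves the attachment
condition.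

New vertices go into a gap around `v` that holds no other vertex of `S`. An edge between consecutive
positions crosses nothing, so a pendant path can be inserted vertex by vertex on any page
(`IsLayout.exists_pendantChain`); these edges, a spanning tree, use page `2`. From a cycle one edge
`x → y` is set aside, which leaves two chains hanging from `v`. Acyclicity allows a choice of `x →
y` for which nesting one chain closer to `v` than the other puts `x` before `y`
(`List.IsChain.exists_split`, `IsLayout.exists_cycle`). Strictly between `x` and `y` there are only
`v` and new vertices, so `x → y` merely needs a page that no edge at `v` uses: the page `col v ∈ {0,
1}` reserved at `v`. The new vertices reserve the other one of `0` and `1`. Each block thus meets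
page `2` and at most one more page, and three of the six pages suffice. -/

namespace SimpleGraph

/-! ### Walks that avoid a set, and cycles in a cactus -/

variable {V : Type*} {H : SimpleGraph V}

/-- Two vertices are joined off `S` if some walk between them contains no vertex of `S`. -/
def JoinedOff (H : SimpleGraph V) (S : Set V) (a b : V) : Prop :=
  ∃ p : H.Walk a b, ∀ x ∈ p.support, x ∉ S

namespace JoinedOff

variable {S T : Set V} {a b c : V}

lemma refl (h : a ∉ S) : H.JoinedOff S a a := ⟨.nil, by simpa using h⟩

lemma symm (h : H.JoinedOff S a b) : H.JoinedOff S b a := by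
  obtain ⟨p, hp⟩ := h
  exact ⟨p.reverse, by simpa using hp⟩

lemma trans (h : H.JoinedOff S a b) (h' : H.JoinedOff S b c) : H.JoinedOff S a c := by
  obtain ⟨p, hp⟩ := h
  obtain ⟨q, hq⟩ := h'
  refine ⟨p.append q, fun x hx => ?_⟩
  rw [Walk.mem_support_append_iff] at hx
  exact hx.elim (hp x) (hq x)

lemma mono (h : H.JoinedOff S a b) (hTS : T ⊆ S) : H.JoinedOff T a b := by
  obtain ⟨p, hp⟩ := h
  exact ⟨p, fun x hx hT => hp x hx (hTS hT)⟩

lemma of_adj (h : H.Adj a b) (ha : a ∉ S) (hb : b ∉ S) : H.JoinedOff S a b :=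
  ⟨h.toWalk, by simp [ha, hb]⟩

lemma left_notMem (h : H.JoinedOff S a b) : a ∉ S := by
  obtain ⟨p, hp⟩ := h
  exact hp a p.start_mem_support

lemma right_notMem (h : H.JoinedOff S a b) : b ∉ S := h.symm.left_notMem

lemma of_mem_support {p : H.Walk a b} (hp : ∀ x ∈ p.support, x ∉ S) {x y : V}
    (hx : x ∈ p.support) (hy : y ∈ p.support) : H.JoinedOff S x y := by
  classical
  have key : ∀ z ∈ p.support, H.JoinedOff S a z := fun z hz =>
    ⟨p.takeUntil z hz, fun w hw => hp w (p.support_takeUntil_subset_support hz hw)⟩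
  exact (key x hx).symm.trans (key y hy)

end JoinedOff

lemma isCycle_cons_concat {a w u : V} {p : H.Walk w u} (hp : p.IsPath) (ha : a ∉ p.support)
    (haw : H.Adj a w) (hua : H.Adj u a) (huw : u ≠ w) :
    (Walk.cons haw (p.concat hua)).IsCycle := by
  rw [Walk.cons_isCycle_iff]
  refine ⟨hp.concat ha hua, fun h => ?_⟩
  rw [Walk.edges_concat, List.concat_eq_append, List.mem_append] at h
  rcases h with h | h
  · exact ha (p.fst_mem_support_of_mem_edges h)
  · simp only [List.mem_singleton, Sym2.eq_iff] at h
    rcases h with ⟨h, -⟩ | ⟨-, h⟩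
    · exact hua.ne h.symm
    · exact huw h.symm

/-- Closed up through `a`, both paths become cycles that share `a` and `w`; in a cactus these are
the same cycle. -/
lemma IsCactus.mem_support_of_isPath (hH : H.IsCactus) {a w u₁ u₂ : V}
    {p : H.Walk w u₁} {q : H.Walk w u₂} (hp : p.IsPath) (hq : q.IsPath)
    (hap : a ∉ p.support) (haq : a ∉ q.support) (haw : H.Adj a w)
    (h₁ : H.Adj a u₁) (h₂ : H.Adj a u₂) (n₁ : u₁ ≠ w) (n₂ : u₂ ≠ w) : u₁ ∈ q.support := by
  have c₁ := isCycle_cons_concat hp hap haw h₁.symm n₁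
  have c₂ := isCycle_cons_concat hq haq haw h₂.symm n₂
  by_cases heq : (Walk.cons haw (p.concat h₁.symm)).toSubgraph =
      (Walk.cons haw (q.concat h₂.symm)).toSubgraph
  · have hm : u₁ ∈ (Walk.cons haw (p.concat h₁.symm)).toSubgraph.verts := by
      simp [Walk.support_concat]
    rw [heq] at hm
    simp only [Walk.mem_verts_toSubgraph, Walk.support_cons, Walk.support_concat,
      List.mem_cons, List.mem_append, List.not_mem_nil, or_false] at hm
    rcases hm with h | h | h
    · exact absurd h h₁.ne'
    · exact h
    · exact absurd h h₁.ne'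
  · refine absurd (hH.2 _ _ _ _ c₁ c₂ heq (x := a) ?_ (y := w) ?_) haw.ne <;>
      simp [Walk.support_concat]

/-- In a cactus, a component left by the deletion of a vertex contains at most two of its
neighbours. -/
lemma IsCactus.not_three_neighbors (hH : H.IsCactus) {a w u₁ u₂ : V}
    (haw : H.Adj a w) (h₁ : H.Adj a u₁) (h₂ : H.Adj a u₂)
    (n₁ : u₁ ≠ w) (n₂ : u₂ ≠ w) (n₁₂ : u₁ ≠ u₂)
    (j₁ : H.JoinedOff {a} w u₁) (j₂ : H.JoinedOff {a} w u₂) : False := by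
  classical
  obtain ⟨p, hp⟩ := j₁
  obtain ⟨q, hq⟩ := j₂
  have hap : a ∉ p.bypass.support := fun h => hp a (p.support_bypass_subset_support h) rfl
  have haq : a ∉ q.bypass.support := fun h => hq a (q.support_bypass_subset_support h) rfl
  have hm : u₂ ∈ p.bypass.support := hH.mem_support_of_isPath q.bypass_isPath p.bypass_isPath
    haq hap haw h₂ h₁ n₂ n₁
  have hsub := p.bypass.support_takeUntil_subset_support hm
  -- The path to `u₁` passes through `u₂`. Cut off there, it no longer contains `u₁`, but as a path
  -- from `w` to `u₂` it would have to.
  have := hH.mem_support_of_isPath p.bypass_isPath (p.bypass_isPath.takeUntil hm) hap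
    (fun h => hap (hsub h)) haw h₁ h₂ n₁ n₂
  exact Walk.endpoint_notMem_support_takeUntil p.bypass_isPath hm n₁₂ this

/-- A list is chordless if each entry is related to no later entry but the next one. -/
def _root_.List.Chordless (r : V → V → Prop) : List V → Prop
  | [] => True
  | a :: l => (∀ b ∈ l, r a b → l.head? = some b) ∧ l.Chordless r

/-- The walk `q` leads from the predecessor `z` of `u` to the end of the path without touching the
path earlier. A chord from `u` to `b` would therefore give `u` three neighbours, `z`, `b` and its
successor, joined to each other off `u`. -/
lemma IsCactus.chordless_support_aux (hH : H.IsCactus) {u u' : V} (p : H.Walk u u') :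
    ∀ {z : V} (q : H.Walk z u'), p.IsPath → H.Adj z u → z ∉ p.support →
      (∀ x ∈ q.support, x ∈ p.support → x = u') → p.support.Chordless H.Adj := by
  induction p with
  | nil => intros; simp [List.Chordless]
  | @cons u c u' huc p ih =>
    intro z q hp hzu hz hq
    rw [Walk.cons_isPath_iff] at hp
    have hu' : u' ≠ u := fun h => hp.2 (h ▸ p.end_mem_support)
    simp only [Walk.support_cons, List.mem_cons, not_or] at hz hq
    have huq : u ∉ q.support := fun h => hu' (hq u h (Or.inl rfl)).symm
    have hoff : ∀ x ∈ p.support, x ∉ ({u} : Set V) := fun x hx h => hp.2 (h ▸ hx)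
    rw [Walk.support_cons]
    refine ⟨fun b hb hub => ?_, ih (.cons hzu.symm q) hp.1 huc hp.2 ?_⟩
    · have hhead : p.support.head? = some c := by cases p <;> rfl
      rw [hhead]
      by_contra hne
      have hcb : b ≠ c := fun h => hne (by rw [h])
      refine hH.not_three_neighbors huc hub hzu.symm hcb ?_ ?_
        (JoinedOff.of_mem_support hoff p.start_mem_support hb)
        ((JoinedOff.of_mem_support hoff p.start_mem_support p.end_mem_support).trans
          ⟨q.reverse, by simpa using fun x hx => (fun h : x = u => huq (h ▸ hx))⟩)
      · rintro rfl; exact hz.2 p.start_mem_support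
      · rintro rfl; exact hz.2 hb
    · intro x hx hxp
      rw [Walk.support_cons, List.mem_cons] at hx
      rcases hx with rfl | hx
      · exact absurd hxp hp.2
      · exact hq x hx (Or.inr hxp)

/-- A path whose ends are neighbours of a vertex off the path is induced in a cactus, but for the
edge that may join its ends. -/
lemma IsCactus.chordless_support (hH : H.IsCactus) {u u' v : V} {p : H.Walk u u'} (hp : p.IsPath)
    (hv : v ∉ p.support) (hu : H.Adj v u) (hu' : H.Adj v u') : p.support.Chordless H.Adj := by
  refine hH.chordless_support_aux p hu'.toWalk hp hu hv fun x hx hxp => ?_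
  simp only [Walk.support_cons, Walk.support_nil, List.mem_cons, List.not_mem_nil, or_false,
    Adj.toWalk] at hx
  rcases hx with rfl | rfl
  · exact absurd hxp hv
  · rfl

lemma Walk.IsCycle.exists_walk_between_neighbors {v a : V} {c : H.Walk v v} (hc : c.IsCycle)
    (ha : a ∈ c.support) : ∃ s t, s ≠ t ∧ H.Adj a s ∧ H.Adj a t ∧ ∃ q : H.Walk s t,
      a ∉ q.support ∧ ∀ x, x ∈ q.support ↔ x ∈ c.support ∧ x ≠ a := by
  classical
  have hc' := hc.rotate ha
  have hmem : ∀ x, x ∈ (c.rotate a ha).support ↔ x ∈ c.support := fun x => by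
    simp
  revert hc' hmem
  generalize c.rotate a ha = d
  intro hd hmem
  cases d with
  | nil => exact absurd hd (by simp)
  | @cons _ s _ has q =>
    obtain ⟨hq, he⟩ := (Walk.cons_isCycle_iff _ _).1 hd
    have hrev : ∃ t, ∃ q' : H.Walk s t, ∃ hta : H.Adj t a, q = q'.concat hta := by
      cases q with
      | nil => exact absurd has (H.loopless.irrefl _)
      | cons h q =>
        obtain ⟨t, q', h', e⟩ := Walk.exists_cons_eq_concat h q
        exact ⟨t, q', h', e⟩
    obtain ⟨t, q', hta, rfl⟩ := hrev
    rw [Walk.concat_isPath_iff] at hq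
    refine ⟨s, t, ?_, has, hta.symm, q', hq.2, fun x => ?_⟩
    -- If `s = t`, the cycle would use the edge between `a` and `s` twice.
    · rintro rfl
      exact he (by simp [Walk.edges_concat, Sym2.eq_swap])
    · rw [← hmem]
      simp only [Walk.support_cons, Walk.support_concat, List.mem_cons,
        List.mem_append, List.not_mem_nil, or_false]
      constructor
      · intro hx
        exact ⟨Or.inr (Or.inl hx), fun h => hq.2 (h ▸ hx)⟩
      · rintro ⟨rfl | h | rfl, hn⟩
        · exact absurd rfl hn
        · exact h
        · exact absurd rfl hn

/-! ### Sets with single attachment -/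

/-- Every component of the complement of `S` has at most one neighbour in `S`. -/
def SingleAttachment (H : SimpleGraph V) (S : Set V) : Prop :=
  ∀ a ∈ S, ∀ a' ∈ S, ∀ w w', H.JoinedOff S w w' → H.Adj a w → H.Adj a' w' → a = a'

/-- A component attached both to `u` and to some `a ∈ S` lay, before the insertion, in the component
of `u`. Hence `a = v`, and `hone` leaves `u` itself as the only contact. -/
lemma SingleAttachment.insert {S : Set V} (hS : H.SingleAttachment S) {v u : V} (hv : v ∈ S)
    (hvu : H.Adj v u) (hun : u ∉ S)
    (hone : ∀ u', H.Adj v u' → H.JoinedOff S u u' → u' = u) :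
    H.SingleAttachment (insert u S) := by
  have key : ∀ a ∈ S, ∀ w w', H.JoinedOff (Insert.insert u S) w w' → H.Adj u w → H.Adj a w' →
      False := by
    intro a ha w w' hj huw haw
    have hj' := (JoinedOff.of_adj huw hun (hj.mono (Set.subset_insert _ _)).left_notMem).trans
      (hj.mono (Set.subset_insert _ _))
    have := hS a ha v hv w' u hj'.symm haw hvu
    subst this
    exact hj.right_notMem (Or.inl (hone w' haw hj'))
  rintro a (rfl | ha) a' (rfl | ha') w w' hj haw haw'
  · rfl
  · exact (key a' ha' w w' hj haw haw').elim
  · exact (key a ha w' w hj.symm haw' haw).elim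
  · exact hS a ha a' ha' w w' (hj.mono (Set.subset_insert _ _)) haw haw'

/-- If a component were attached to a path vertex `a` and to some other `a'`, then `a'` would be on
the cycle through `v` and the path. So `a` would have three neighbours joined off `a`: two on the
cycle, and `w` by way of `a'`. -/
lemma SingleAttachment.union_support {S : Set V} (hH : H.IsCactus) (hS : H.SingleAttachment S)
    {v u u' : V} (hv : v ∈ S) {p : H.Walk u u'} (hp : p.IsPath) (hpS : ∀ x ∈ p.support, x ∉ S)
    (hu : H.Adj v u) (hu' : H.Adj v u') (hne : u' ≠ u) :
    H.SingleAttachment (S ∪ {x | x ∈ p.support}) := by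
  have hvp : v ∉ p.support := fun h => hpS v h hv
  have hc := isCycle_cons_concat hp hvp hu hu'.symm hne
  have key : ∀ a ∈ p.support, ∀ a' ∈ S ∪ {x | x ∈ p.support}, ∀ w w',
      H.JoinedOff (S ∪ {x | x ∈ p.support}) w w' → H.Adj a w → H.Adj a' w' → a = a' := by
    intro a ha a' ha' w w' hj haw haw'
    by_contra hn
    have hjS := hj.mono (T := S) Set.subset_union_left
    have hawS := JoinedOff.of_adj haw (hpS a ha) hjS.left_notMem
    have ha'' : a' = v ∨ a' ∈ p.support := by
      rcases ha' with h | h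
      · exact Or.inl (hS a' h v hv w' u (((JoinedOff.of_mem_support hpS p.start_mem_support ha).trans
          hawS).trans hjS).symm haw' hu)
      · exact Or.inr h
    obtain ⟨s, t, hst, has, hat, q, hq, hqm⟩ := hc.exists_walk_between_neighbors (a := a)
      (by simp [Walk.support_concat, ha])
    have hmem : ∀ x, x ∈ q.support ↔ (x = v ∨ x ∈ p.support) ∧ x ≠ a := by
      intro x
      rw [hqm]
      simp only [Walk.support_cons, Walk.support_concat, List.mem_cons,
        List.mem_append, List.not_mem_nil, or_false]
      tauto
    have hoff : ∀ x ∈ q.support, x ∉ ({a} : Set V) := fun x hx h => ((hmem x).1 hx).2 h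
    have hwC : w ∉ q.support := fun h => by
      rcases ((hmem w).1 h).1 with rfl | h
      · exact hj.left_notMem (Or.inl hv)
      · exact hj.left_notMem (Or.inr h)
    have ha'q : a' ∈ q.support := (hmem a').2 ⟨ha'', Ne.symm hn⟩
    have hja : H.JoinedOff {a} w w' := hj.mono (by
      rintro x rfl
      exact Or.inr ha)
    refine hH.not_three_neighbors has hat haw hst.symm ?_ ?_
      (JoinedOff.of_mem_support hoff q.start_mem_support q.end_mem_support)
      ((JoinedOff.of_mem_support hoff q.start_mem_support ha'q).trans
        ((JoinedOff.of_adj haw' (fun h => hn h.symm) hja.right_notMem).trans hja.symm))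
    · rintro rfl; exact hwC q.start_mem_support
    · rintro rfl; exact hwC q.end_mem_support
  rintro a (ha | ha) a' (ha' | ha') w w' hj haw haw'
  · exact hS a ha a' ha' w w' (hj.mono Set.subset_union_left) haw haw'
  · exact (key a' ha' a (Or.inl ha) w' w hj.symm haw' haw).symm
  · exact key a ha a' (Or.inl ha') w w' hj haw haw'
  · exact key a ha a' (Or.inr ha') w w' hj haw haw'

/-! ### Nonseparable subgraphs and cut-vertices -/

lemma Subgraph.Preconnected.exists_adj_boundary {B : H.Subgraph} (hB : B.Preconnected) {x y : V}
    (hx : x ∈ B.verts) (hy : y ∈ B.verts) (K : Set V) (hxK : x ∈ K) (hyK : y ∉ K) :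
    ∃ a b, B.Adj a b ∧ a ∈ K ∧ b ∉ K := by
  obtain ⟨p⟩ := hB.coe ⟨x, hx⟩ ⟨y, hy⟩
  obtain ⟨d, -, h₁, h₂⟩ := p.exists_boundary_dart (Subtype.val ⁻¹' K) hxK hyK
  exact ⟨d.fst, d.snd, d.adj, h₁, h₂⟩

/-- Only `v` links `S` to `K`, so a subgraph that stays connected without `v` cannot have further
vertices on both sides. -/
lemma Subgraph.IsNonseparable.subset_or_subset {B : H.Subgraph} (hB : B.IsNonseparable)
    {S K : Set V} {v : V} (hsub : B.verts ⊆ S ∪ K)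
    (hKS : ∀ a ∈ S, a ≠ v → ∀ b ∈ K, ¬ H.Adj a b) (hvK : v ∉ K) :
    B.verts ⊆ S ∨ B.verts ⊆ insert v K := by
  by_contra! hcon
  obtain ⟨⟨y, hy, hyS⟩, x, hx, hxK⟩ := And.imp Set.not_subset.1 Set.not_subset.1 hcon
  rw [Set.mem_insert_iff, not_or] at hxK
  have hyK : y ∈ K := (hsub hy).resolve_left hyS
  have main : ∃ a b, B.Adj a b ∧ a ≠ v ∧ b ≠ v ∧ a ∈ S ∧ b ∉ S := by
    have hxS : x ∈ S := (hsub hx).resolve_right hxK.2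
    by_cases hvB : v ∈ B.verts
    · obtain ⟨a, b, hab, ha, hb⟩ := (hB.2 v hvB).exists_adj_boundary (x := x) (y := y)
        ⟨hx, hxK.1⟩ ⟨hy, fun h => hvK (h ▸ hyK)⟩ S hxS hyS
      rw [Subgraph.deleteVerts_adj] at hab
      exact ⟨a, b, hab.2.2.2.2, hab.2.1, hab.2.2.2.1, ha, hb⟩
    · obtain ⟨a, b, hab, ha, hb⟩ := Subgraph.Preconnected.exists_adj_boundary
        ⟨hB.1.coe.preconnected⟩ hx hy S hxS hyS
      exact ⟨a, b, hab, fun h => hvB (h ▸ B.edge_vert hab),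
        fun h => hvB (h ▸ B.edge_vert hab.symm), ha, hb⟩
  obtain ⟨a, b, hab, hav, -, ha, hb⟩ := main
  exact hKS a ha hav b ((hsub (B.edge_vert hab.symm)).resolve_left hb) (B.adj_sub hab)

end SimpleGraph

/-! ### Linear layouts and the insertion of chains and cycles -/

section Layout

variable {V : Type*}

/-- `f` places the vertices of `S` on a line, such that the edges between them (the pairs related
by `A`) point upward and no two of them cross if they are on the same page. -/
structure IsLayout (A : V → V → Prop) (page : V → V → Fin 6) (S : Set V) (f : V → ℝ) : Prop where
  injOn : Set.InjOn f S
  lt : ∀ a ∈ S, ∀ b ∈ S, A a b → f a < f b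
  not_cross : ∀ a ∈ S, ∀ b ∈ S, ∀ c ∈ S, ∀ d ∈ S, A a b → A c d → page a b = page c d →
    ¬ (f a < f c ∧ f c < f b ∧ f b < f d)

/-- The vertices of `l` form an induced path that hangs from `w` and has no other contact
with `S`. -/
structure IsPendantChain (A : V → V → Prop) (S : Set V) (w : V) (l : List V) : Prop where
  sep : ∀ a ∈ S, a ≠ w → ∀ b ∈ l, ¬ (A a b ∨ A b a)
  chordless : (w :: l).Chordless fun a b => A a b ∨ A b a
  isChain : (w :: l).IsChain fun a b => A a b ∨ A b a
  nodup : l.Nodup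
  disjoint : ∀ b ∈ l, b ∉ S

variable {A : V → V → Prop} {page : V → V → Fin 6} {S : Set V} {f : V → ℝ}

/-- Once `c` is placed it becomes the anchor of the rest; chordlessness excludes contacts of the old
anchor with later vertices. -/
lemma IsPendantChain.tail {w c : V} {l : List V} (h : IsPendantChain A S w (c :: l)) :
    IsPendantChain A (insert c S) c l where
  sep := by
    rintro a (rfl | ha) hac b hb
    · exact absurd rfl hac
    · by_cases haw : a = w
      · subst haw
        intro hab
        have := h.chordless.1 b (List.mem_cons_of_mem _ hb) hab
        simp only [List.head?_cons, Option.some.injEq] at this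
        exact (List.nodup_cons.1 h.nodup).1 (this ▸ hb)
      · exact h.sep a ha haw b (List.mem_cons_of_mem _ hb)
  chordless := h.chordless.2
  isChain := (List.isChain_cons_cons.1 h.isChain).2
  nodup := (List.nodup_cons.1 h.nodup).2
  disjoint := by
    rintro b hb (rfl | hbS)
    · exact (List.nodup_cons.1 h.nodup).1 hb
    · exact h.disjoint b (List.mem_cons_of_mem _ hb) hbS

lemma IsPendantChain.union {w : V} {l l' : List V} (h : IsPendantChain A S w l)
    (hsep : ∀ a ∈ l', ∀ b ∈ l, ¬ (A a b ∨ A b a)) (hdisj : ∀ b ∈ l, b ∉ l') :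
    IsPendantChain A (S ∪ {x | x ∈ l'}) w l where
  sep := by
    rintro a (ha | ha) haw b hb
    · exact h.sep a ha haw b hb
    · exact hsep a ha b hb
  chordless := h.chordless
  isChain := h.isChain
  nodup := h.nodup
  disjoint := by
    rintro b hb (hbS | hbl)
    · exact h.disjoint b hb hbS
    · exact hdisj b hb hbl

lemma Set.InjOn.exists_gap (hf : S.InjOn f) (hS : S.Finite) {w : V} (hw : w ∈ S) :
    ∃ ε > 0, ∀ s ∈ S, s ≠ w → ε ≤ |f s - f w| := by
  by_cases hne : (S \ {w}).Nonempty
  · obtain ⟨m, hm, hmin⟩ := Set.exists_min_image (S \ {w}) (fun s => |f s - f w|)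
      (hS.subset Set.sdiff_subset) hne
    refine ⟨|f m - f w|, abs_pos.2 (sub_ne_zero.2 fun h => hm.2 (hf hm.1 hw h)), ?_⟩
    exact fun s hs hsw => hmin s ⟨hs, hsw⟩
  · refine ⟨1, one_pos, fun s hs hsw => (hne ⟨s, hs, hsw⟩).elim⟩

/-- By `hgap` no vertex lies strictly between `u` and `w`, so the new edge crosses nothing, whatever
its page. -/
lemma IsLayout.insert_pendant [DecidableEq V] (hL : IsLayout A page S f) {w u : V} (hw : w ∈ S)
    (hu : u ∉ S) (hA : ∀ a ∈ S, a ≠ w → ¬ (A a u ∨ A u a)) (huu : ¬ A u u) {t : ℝ}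
    (ht : t ≠ f w) (h₁ : A w u → f w < t) (h₂ : A u w → t < f w)
    (hgap : ∀ s ∈ S, s ≠ w → (f s < f w ∧ f s < t) ∨ (f w < f s ∧ t < f s)) :
    IsLayout A page (insert u S) (Function.update f u t) := by
  set g := Function.update f u t with hg
  have gu : g u = t := by simp [hg]
  have gS : ∀ s ∈ S, g s = f s := fun s hs => Function.update_of_ne (ne_of_mem_of_not_mem hs hu) _ _
  have hgap' : ∀ s ∈ insert u S, ¬ (g u < g s ∧ g s < g w) ∧ ¬ (g w < g s ∧ g s < g u) := by
    rintro s (rfl | hs)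
    · constructor <;> rintro ⟨h, h'⟩ <;> linarith
    · rw [gu, gS s hs, gS w hw]
      by_cases hsw : s = w
      · subst hsw
        constructor <;> rintro ⟨h, h'⟩ <;> linarith
      · rcases hgap s hs hsw with h | h <;> constructor <;> rintro ⟨h, h'⟩ <;> linarith
  have hedge : ∀ a ∈ insert u S, ∀ b ∈ insert u S, A a b →
      (a ∈ S ∧ b ∈ S) ∨ (a = u ∧ b = w) ∨ (a = w ∧ b = u) := by
    rintro a (rfl | ha) b (rfl | hb) hab
    · exact absurd hab huu
    · by_cases h : b = w
      · exact Or.inr (Or.inl ⟨rfl, h⟩)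
      · exact absurd (Or.inr hab) (hA b hb h)
    · by_cases h : a = w
      · exact Or.inr (Or.inr ⟨h, rfl⟩)
      · exact absurd (Or.inl hab) (hA a ha h)
    · exact Or.inl ⟨ha, hb⟩
  refine ⟨?_, ?_, ?_⟩
  · have hne : ∀ s ∈ S, g s ≠ t := by
      intro s hs h
      rw [gS s hs] at h
      by_cases hsw : s = w
      · exact ht (hsw ▸ h.symm)
      · rcases hgap s hs hsw with h' | h' <;> linarith [h'.2]
    rintro a (rfl | ha) b (rfl | hb) hab
    · rfl
    · exact absurd (hab.symm.trans gu) (hne b hb)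
    · exact absurd (hab.trans gu) (hne a ha)
    · rw [gS a ha, gS b hb] at hab
      exact hL.injOn ha hb hab
  · intro a ha b hb hab
    rcases hedge a ha b hb hab with ⟨ha, hb⟩ | ⟨rfl, rfl⟩ | ⟨rfl, rfl⟩
    · rw [gS a ha, gS b hb]
      exact hL.lt a ha b hb hab
    · rw [gu, gS _ hw]
      exact h₂ hab
    · rw [gu, gS _ hw]
      exact h₁ hab
  · intro a ha b hb c hc d hd hab hcd hpage hcross
    rcases hedge a ha b hb hab with ⟨haS, hbS⟩ | ⟨rfl, rfl⟩ | ⟨rfl, rfl⟩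
    · rcases hedge c hc d hd hcd with ⟨hcS, hdS⟩ | ⟨rfl, rfl⟩ | ⟨rfl, rfl⟩
      · rw [gS a haS, gS b hbS, gS c hcS, gS d hdS] at hcross
        exact hL.not_cross a haS b hbS c hcS d hdS hab hcd hpage hcross
      · exact (hgap' b hb).1 hcross.2
      · exact (hgap' b hb).2 hcross.2
    · exact (hgap' c hc).1 ⟨hcross.1, hcross.2.1⟩
    · exact (hgap' c hc).2 ⟨hcross.1, hcross.2.1⟩

lemma IsLayout.congr (hL : IsLayout A page S f) {B : V → V → Prop} {page' : V → V → Fin 6}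
    {g : V → ℝ} (hB : ∀ a ∈ S, ∀ b ∈ S, B a b → A a b ∧ page' a b = page a b)
    (hg : Set.EqOn g f S) : IsLayout B page' S g where
  injOn := hL.injOn.congr hg.symm
  lt a ha b hb hab := by
    rw [hg ha, hg hb]
    exact hL.lt a ha b hb (hB a ha b hb hab).1
  not_cross a ha b hb c hc d hd hab hcd hpage := by
    rw [hg ha, hg hb, hg hc, hg hd]
    obtain ⟨hab, e⟩ := hB a ha b hb hab
    obtain ⟨hcd, e'⟩ := hB c hc d hd hcd
    exact hL.not_cross a ha b hb c hc d hd hab hcd (e ▸ e' ▸ hpage)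

/-- A pendant chain can be placed as close to its anchor as one likes, on the side determined by
its first edge. -/
lemma IsLayout.exists_pendantChain (hA : ∀ a b, A a b → ¬ A b a) (l : List V) :
    ∀ {S : Set V} {f : V → ℝ} {w : V}, IsLayout A page S f → S.Finite → w ∈ S →
      IsPendantChain A S w l → ∀ δ > 0, ∃ g : V → ℝ, Set.EqOn g f S ∧
        IsLayout A page (S ∪ {x | x ∈ l}) g ∧ (∀ x ∈ l, |g x - f w| < δ) ∧
        ∀ c ∈ l.head?, (A w c → ∀ x ∈ l, f w < g x) ∧ (A c w → ∀ x ∈ l, g x < f w) := by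
  classical
  induction l with
  | nil =>
    intro S f w hL _ _ _ δ _
    exact ⟨f, fun _ _ => rfl, by simpa using hL, by simp, by simp⟩
  | cons c l ih =>
    intro S f w hL hS hw hl δ hδ
    obtain ⟨ε₀, hε₀, hgap₀⟩ := hL.injOn.exists_gap hS hw
    obtain ⟨ε, hε, hεδ, hgap⟩ : ∃ ε > 0, ε ≤ δ ∧ ∀ s ∈ S, s ≠ w → ε ≤ |f s - f w| :=
      ⟨min ε₀ δ, lt_min hε₀ hδ, min_le_right _ _,
        fun s hs hsw => (min_le_left _ _).trans (hgap₀ s hs hsw)⟩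
    have hc : c ∉ S := hl.disjoint c List.mem_cons_self
    -- With `c` at distance `ε / 2` from `w` and the rest less than `ε / 2` away from `c`, the chain
    -- stays on one side of `w` and within `ε ≤ δ` of it.
    have step : ∀ t : ℝ, |t - f w| = ε / 2 → (A w c → f w < t) → (A c w → t < f w) →
        ∃ g : V → ℝ, Set.EqOn g f S ∧ IsLayout A page (S ∪ {x | x ∈ c :: l}) g ∧
          ∀ x ∈ c :: l, |g x - t| < ε / 2 := by
      intro t ht h₁ h₂
      have hL' := hL.insert_pendant (u := c) (t := t) hw hc
        (fun a ha haw => hl.sep a ha haw c List.mem_cons_self) (fun h => hA _ _ h h)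
        (fun h => by rw [h, sub_self, abs_zero] at ht; linarith) h₁ h₂ (by
          intro s hs hsw
          have h := hgap s hs hsw
          rcases le_abs.1 h with h | h <;> rcases (abs_eq (by linarith)).1 ht with h' | h'
          · right; constructor <;> linarith
          · right; constructor <;> linarith
          · left; constructor <;> linarith
          · left; constructor <;> linarith)
      obtain ⟨g, hgE, hgL, hgd, -⟩ := ih hL' (hS.insert c) (Set.mem_insert c S) hl.tail (ε / 2)
        (by linarith)
      refine ⟨g, fun s hs => ?_, ?_, ?_⟩
      · rw [hgE (Set.mem_insert_of_mem _ hs)]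
        exact Function.update_of_ne (ne_of_mem_of_not_mem hs hc) _ _
      · convert hgL using 1
        ext x
        simp only [Set.mem_union, Set.mem_ofPred_eq, List.mem_cons, Set.mem_insert_iff]
        tauto
      · rw [Function.update_self] at hgd
        intro x hx
        rcases List.mem_cons.1 hx with rfl | hx
        · rw [hgE (Set.mem_insert _ S), Function.update_self, sub_self, abs_zero]
          linarith
        · exact hgd x hx
    rcases (List.isChain_cons_cons.1 hl.isChain).1 with hwc | hcw
    · obtain ⟨g, hgE, hgL, hgd⟩ := step (f w + ε / 2)
        (by rw [add_sub_cancel_left]; exact abs_of_pos (by linarith))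
        (fun _ => by linarith) (fun h => absurd h (hA _ _ hwc))
      refine ⟨g, hgE, hgL, fun x hx => ?_, ?_⟩
      · have := abs_lt.1 (hgd x hx)
        exact abs_lt.2 ⟨by linarith, by linarith⟩
      · simp only [List.head?_cons, Option.mem_some_iff, forall_eq']
        refine ⟨fun _ x hx => ?_, fun h => absurd h (hA _ _ hwc)⟩
        have := abs_lt.1 (hgd x hx)
        linarith
    · obtain ⟨g, hgE, hgL, hgd⟩ := step (f w - ε / 2)
        (by rw [sub_sub_cancel_left, abs_neg]; exact abs_of_pos (by linarith))
        (fun h => absurd h (hA _ _ hcw)) (fun _ => by linarith)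
      refine ⟨g, hgE, hgL, fun x hx => ?_, ?_⟩
      · have := abs_lt.1 (hgd x hx)
        exact abs_lt.2 ⟨by linarith, by linarith⟩
      · simp only [List.head?_cons, Option.mem_some_iff, forall_eq']
        refine ⟨fun h => absurd h (hA _ _ hcw), fun _ x hx => ?_⟩
        have := abs_lt.1 (hgd x hx)
        linarith

/-- `Q` is inserted after `P`, into a gap around `v` that already excludes `P`; this nests it closer
to `v`. -/
lemma IsLayout.exists_two_pendantChains (hA : ∀ a b, A a b → ¬ A b a) {P Q : List V} {v : V}
    (hL : IsLayout A page S f) (hS : S.Finite) (hv : v ∈ S) (hP : IsPendantChain A S v P)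
    (hQ : IsPendantChain A (S ∪ {x | x ∈ P}) v Q) {δ : ℝ} (hδ : 0 < δ) :
    ∃ g : V → ℝ, Set.EqOn g f S ∧ IsLayout A page (S ∪ {x | x ∈ P} ∪ {x | x ∈ Q}) g ∧
      (∀ x ∈ P, |g x - f v| < δ) ∧ (∀ x ∈ Q, |g x - f v| < δ) ∧
      (∀ p ∈ P, ∀ q ∈ Q, |g q - f v| < |g p - f v|) ∧
      ∀ c ∈ P.head?, (A v c → ∀ x ∈ P, f v < g x) ∧ (A c v → ∀ x ∈ P, g x < f v) := by
  obtain ⟨g₁, hE₁, hL₁, hd₁, hs₁⟩ := hL.exists_pendantChain hA P hS hv hP δ hδ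
  have hv' : v ∈ S ∪ {x | x ∈ P} := Or.inl hv
  have hS' : (S ∪ {x | x ∈ P}).Finite := hS.union (List.finite_toSet P)
  obtain ⟨ε, hε, hgap⟩ := hL₁.injOn.exists_gap hS' hv'
  obtain ⟨g₂, hE₂, hL₂, hd₂, -⟩ := hL₁.exists_pendantChain hA Q hS' hv' hQ (min ε δ)
    (lt_min hε hδ)
  rw [hE₁ hv] at hd₂ hgap
  have hP₂ : ∀ x ∈ P, g₂ x = g₁ x := fun x hx => hE₂ (Or.inr hx)
  refine ⟨g₂, fun s hs => (hE₂ (Or.inl hs)).trans (hE₁ hs), hL₂, fun x hx => ?_,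
    fun x hx => (hd₂ x hx).trans_le (min_le_right _ _), fun p hp q hq => ?_, fun c hc => ?_⟩
  · rw [hP₂ x hx]
    exact hd₁ x hx
  · rw [hP₂ p hp]
    refine ((hd₂ q hq).trans_le (min_le_left _ _)).trans_le (hgap p (Or.inr hp) ?_)
    rintro rfl
    exact hP.disjoint p hp hv
  · refine ⟨fun h x hx => ?_, fun h x hx => ?_⟩ <;> rw [hP₂ x hx]
    · exact (hs₁ c hc).1 h x hx
    · exact (hs₁ c hc).2 h x hx

lemma IsLayout.add_edge {x y : V} (hL : IsLayout (fun a b => A a b ∧ ¬ (a = x ∧ b = y)) page S f)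
    (hxy : f x < f y) (hfree : ∀ a ∈ S, ∀ b ∈ S, A a b → page a b = page x y →
      ¬ (f x < f a ∧ f a < f y) ∧ ¬ (f x < f b ∧ f b < f y)) : IsLayout A page S f where
  injOn := hL.injOn
  lt a ha b hb hab := by
    by_cases h : a = x ∧ b = y
    · rwa [h.1, h.2]
    · exact hL.lt a ha b hb ⟨hab, h⟩
  not_cross a ha b hb c hc d hd hab hcd hpage hcross := by
    by_cases h : a = x ∧ b = y
    · obtain ⟨rfl, rfl⟩ := h
      exact (hfree c hc d hd hcd hpage.symm).1 ⟨hcross.1, hcross.2.1⟩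
    by_cases h' : c = x ∧ d = y
    · obtain ⟨rfl, rfl⟩ := h'
      exact (hfree a ha b hb hab hpage).2 hcross.2
    exact hL.not_cross a ha b hb c hc d hd ⟨hab, h⟩ ⟨hcd, h'⟩ hpage hcross

/-- A cycle through `v` that consists of two pendant chains `X`, `Y` and an edge from `x ∈ X` to
`y ∈ Y` can be placed next to `v`, unless the first edges force `X` after and `Y` before `v`. -/
lemma IsLayout.exists_cycle (hA : ∀ a b, A a b → ¬ A b a) {X Y : List V} {v x y : V}
    (hL : IsLayout A page S f) (hS : S.Finite) (hv : v ∈ S) (hx : x ∈ X) (hy : y ∈ Y)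
    (hX : IsPendantChain (fun a b => A a b ∧ ¬ (a = x ∧ b = y)) S v X)
    (hY : IsPendantChain (fun a b => A a b ∧ ¬ (a = x ∧ b = y)) S v Y)
    (hXY : ∀ a ∈ X, ∀ b ∈ Y, ¬ ((A a b ∧ ¬ (a = x ∧ b = y)) ∨ (A b a ∧ ¬ (b = x ∧ a = y))))
    (hdisj : ∀ a ∈ X, a ∉ Y) (hside : (∃ c ∈ X.head?, A c v) ∨ ∃ c ∈ Y.head?, A v c)
    (hpage : ∀ a ∈ S ∪ {x | x ∈ X} ∪ {x | x ∈ Y}, ∀ b ∈ S ∪ {x | x ∈ X} ∪ {x | x ∈ Y},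
      A a b → page a b = page x y → (a = x ∧ b = y) ∨ (a ∈ S ∧ a ≠ v ∧ b ∈ S ∧ b ≠ v)) :
    ∃ g : V → ℝ, IsLayout A page (S ∪ {x | x ∈ X} ∪ {x | x ∈ Y}) g := by
  obtain ⟨δ, hδ, hgap⟩ := hL.injOn.exists_gap hS hv
  have hA' : ∀ a b, (A a b ∧ ¬ (a = x ∧ b = y)) → ¬ (A b a ∧ ¬ (b = x ∧ a = y)) :=
    fun a b h h' => hA a b h.1 h'.1
  have hL' : IsLayout (fun a b => A a b ∧ ¬ (a = x ∧ b = y)) page S f :=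
    hL.congr (fun a _ b _ h => ⟨h.1, rfl⟩) fun _ _ => rfl
  have hvX : ∀ c ∈ X, c ≠ v := fun c hc h => hX.disjoint c hc (h ▸ hv)
  have hvY : ∀ c ∈ Y, c ≠ v := fun c hc h => hY.disjoint c hc (h ▸ hv)
  obtain ⟨g, hgE, hgL, hgX, hgY, hgxy⟩ : ∃ g : V → ℝ, Set.EqOn g f S ∧
      IsLayout (fun a b => A a b ∧ ¬ (a = x ∧ b = y)) page (S ∪ {x | x ∈ X} ∪ {x | x ∈ Y}) g ∧
      (∀ c ∈ X, |g c - f v| < δ) ∧ (∀ c ∈ Y, |g c - f v| < δ) ∧ g x < g y := by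
    -- The chain whose side of `v` is known is the outer one: `X` before `v`, or `Y` after `v`. The
    -- inner chain may be on either side and still gives `g x < g y`.
    rcases hside with ⟨c, hc, hcv⟩ | ⟨c, hc, hvc⟩
    · obtain ⟨g, h₁, h₂, h₃, h₄, h₅, h₆⟩ := hL'.exists_two_pendantChains hA' hS hv hX
        (hY.union hXY fun b hb hb' => hdisj b hb' hb) hδ
      refine ⟨g, h₁, h₂, h₃, h₄, ?_⟩
      have hlt := (h₆ c hc).2 ⟨hcv, fun h => hvY y hy h.2.symm⟩ x hx
      have := h₅ x hx y hy
      rw [abs_of_neg (sub_neg.2 hlt)] at this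
      linarith [neg_abs_le (g y - f v)]
    · obtain ⟨g, h₁, h₂, h₃, h₄, h₅, h₆⟩ := hL'.exists_two_pendantChains hA' hS hv hY
        (hX.union (fun a ha b hb h => hXY b hb a ha h.symm) hdisj) hδ
      refine ⟨g, h₁, by rwa [Set.union_right_comm], h₄, h₃, ?_⟩
      have hlt := (h₆ c hc).1 ⟨hvc, fun h => hvX x hx h.1.symm⟩ y hy
      have := h₅ y hy x hx
      rw [abs_of_pos (sub_pos.2 hlt)] at this
      linarith [le_abs_self (g x - f v)]
  refine ⟨g, hgL.add_edge hgxy fun a ha b hb hab hp => ?_⟩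
  rcases hpage a ha b hb hab hp with ⟨rfl, rfl⟩ | ⟨haS, hav, hbS, hbv⟩
  · exact ⟨fun h => h.1.false, fun h => h.2.false⟩
  -- Both `x` and `y` are within `δ` of `v`, where no other vertex of `S` lies.
  · have hwin : ∀ s ∈ S, s ≠ v → ¬ (g x < g s ∧ g s < g y) := by
      intro s hs hsv h
      rw [hgE hs] at h
      have h₁ := abs_lt.1 (hgX x hx)
      have h₂ := abs_lt.1 (hgY y hy)
      exact absurd (hgap s hs hsv) (not_le.2 (abs_lt.2 ⟨by linarith, by linarith⟩))
    exact ⟨hwin a haS hav, hwin b hbS hbv⟩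

end Layout

/-! ### Splitting an induced path at a suitable edge -/

section Chordless

variable {V : Type*} {r r' : V → V → Prop}

lemma List.Chordless.mono {l : List V} (h : l.Chordless r) (hr : ∀ a b, r' a b → r a b) :
    l.Chordless r' := by
  induction l with
  | nil => trivial
  | cons a l ih => exact ⟨fun b hb hab => h.1 b hb (hr a b hab), ih h.2⟩

lemma List.Chordless.left_of_append {l l' : List V} (h : (l ++ l').Chordless r)
    (hd : l.Disjoint l') : l.Chordless r := by
  induction l with
  | nil => trivial
  | cons a l ih =>
    rw [List.disjoint_cons_left] at hd
    refine ⟨fun b hb hab => ?_, ih h.2 hd.2⟩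
    have := h.1 b (List.mem_append_left _ hb) hab
    cases l with
    | nil => simp at hb
    | cons c l => simpa using this

lemma List.Chordless.eq_of_append {l l' : List V} {x y a b : V}
    (h : (l ++ x :: y :: l').Chordless r) (hd : (l ++ [x]).Disjoint (y :: l'))
    (ha : a ∈ l ++ [x]) (hb : b ∈ y :: l') (hab : r a b) : a = x ∧ b = y := by
  induction l with
  | nil =>
    simp only [List.nil_append, List.mem_singleton] at ha
    subst ha
    have := h.1 b hb hab
    exact ⟨rfl, by simpa using this.symm⟩
  | cons c l ih =>
    rw [List.cons_append, List.disjoint_cons_left] at hd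
    rcases List.mem_cons.1 ha with rfl | ha
    · have := h.1 b (List.mem_append_right _ (List.mem_cons_of_mem _ hb)) hab
      have hm : b ∈ l ++ [x] := by
        cases l with
        | nil => simpa using this.symm
        | cons d l => simp at this; simp [this]
      exact absurd hb (hd.2 hm)
    · exact ih h.2 hd.2 ha

/-- If every edge were traversed against its direction, `h` would decrease from `u` to `u'`. -/
lemma List.IsChain.exists_ascent {A : V → V → Prop} {h : V → ℝ} (hA : ∀ a b, A a b → h a < h b)
    {l : List V} (hl : l.IsChain fun a b => A a b ∨ A b a) {u u' : V} (hu : l.head? = some u)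
    (hu' : l.getLast? = some u') (hlt : h u < h u') :
    ∃ l₁ x y l₂, l = l₁ ++ x :: y :: l₂ ∧ A x y := by
  induction l generalizing u with
  | nil => simp at hu
  | cons a l ih =>
    simp only [List.head?_cons, Option.some.injEq] at hu
    subst hu
    cases l with
    | nil =>
      simp only [List.getLast?_singleton, Option.some.injEq] at hu'
      exact absurd hlt (by rw [hu']; exact lt_irrefl _)
    | cons b l =>
      rw [List.isChain_cons_cons] at hl
      rcases hl.1 with hab | hba
      · exact ⟨[], a, b, l, rfl, hab⟩
      · obtain ⟨l₁, x, y, l₂, e, hxy⟩ := ih hl.2 (u := b) rfl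
          (by rwa [List.getLast?_cons_cons] at hu') ((hA _ _ hba).trans hlt)
        exact ⟨a :: l₁, x, y, l₂, by rw [e]; rfl, hxy⟩

/-- A path with both ends joined to `v` has, in one of its two directions, an edge `x → y` such
that the ends do not force the part up to `x` after and the part from `y` before `v`. -/
lemma List.IsChain.exists_split {A : V → V → Prop} {h : V → ℝ} (hA : ∀ a b, A a b → h a < h b)
    {l : List V} (hl : l.IsChain fun a b => A a b ∨ A b a) {u u' v : V} (hu : l.head? = some u)
    (hu' : l.getLast? = some u') (hne : u ≠ u') (hvu : A v u ∨ A u v) (hvu' : A v u' ∨ A u' v) :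
    ∃ l₁ x y l₂, l = l₁ ++ x :: y :: l₂ ∧
      ((A x y ∧ (A u v ∨ A v u')) ∨ (A y x ∧ (A u' v ∨ A v u))) := by
  have hany : ∃ l₁ x y l₂, l = l₁ ++ x :: y :: l₂ ∧ (A x y ∨ A y x) := by
    match l, hl, hu, hu' with
    | [a], _, hu, hu' =>
      simp only [List.head?_cons, Option.some.injEq, List.getLast?_singleton] at hu hu'
      exact absurd (hu.symm.trans hu') hne
    | a :: b :: l, hl, _, _ => exact ⟨[], a, b, l, rfl, (List.isChain_cons_cons.1 hl).1⟩
  rcases hvu with hvu | huv <;> rcases hvu' with hvu' | huv'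
  · obtain ⟨l₁, x, y, l₂, e, hxy⟩ := hany
    exact ⟨l₁, x, y, l₂, e, hxy.imp (⟨·, Or.inr hvu'⟩) (⟨·, Or.inr hvu⟩)⟩
  -- Here `u' → v → u`, so `h` is smaller at `u'` than at `u`, and some edge points from the `u'`
  -- side to the `u` side.
  · obtain ⟨l₁, x, y, l₂, e, hxy⟩ := List.IsChain.exists_ascent (A := fun a b => A b a)
      (h := fun a => - h a) (fun a b hab => neg_lt_neg (hA _ _ hab)) (hl.imp fun _ _ => Or.symm)
      hu hu' (neg_lt_neg ((hA _ _ huv').trans (hA _ _ hvu)))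
    exact ⟨l₁, x, y, l₂, e, Or.inr ⟨hxy, Or.inl huv'⟩⟩
  · obtain ⟨l₁, x, y, l₂, e, hxy⟩ := hl.exists_ascent hA hu hu' ((hA _ _ huv).trans (hA _ _ hvu'))
    exact ⟨l₁, x, y, l₂, e, Or.inl ⟨hxy, Or.inl huv⟩⟩
  · obtain ⟨l₁, x, y, l₂, e, hxy⟩ := hany
    exact ⟨l₁, x, y, l₂, e, hxy.imp (⟨·, Or.inl huv⟩) (⟨·, Or.inl huv'⟩)⟩

end Chordless

/-! ### Partial layouts and their extension -/

namespace Digraph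

variable {V : Type*} {G : Digraph V}

/-- A layout of the part of a digraph within `S`, which no component of the rest meets in two
vertices. Page `2` holds a spanning tree, and no edge at a vertex `v` is on the page `col v`. -/
structure IsPartialLayout (G : Digraph V) (S : Set V) (page : V → V → Fin 6) (col : V → Fin 6)
    (f : V → ℝ) : Prop where
  layout : IsLayout G.Adj page S f
  page_off : ∀ a b, ¬ (a ∈ S ∧ b ∈ S) → page a b = 2
  col_free : ∀ a ∈ S, ∀ b ∈ S, G.Adj a b → page a b ≠ col a ∧ page a b ≠ col b
  col_mem : ∀ a, col a = 0 ∨ col a = 1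
  attachment : G.toSimpleGraphInclusive.SingleAttachment S
  block : ∀ B : G.toSimpleGraphInclusive.Subgraph, B.IsNonseparable → B.verts ⊆ S →
    ∃ p q, ∀ a b, B.Adj a b → G.Adj a b → page a b = p ∨ page a b = q

lemma toSimpleGraphInclusive_adj_iff {h : V → ℝ} (hG : ∀ a b, G.Adj a b → h a < h b) {a b : V} :
    G.toSimpleGraphInclusive.Adj a b ↔ G.Adj a b ∨ G.Adj b a := by
  simp only [toSimpleGraphInclusive, SimpleGraph.fromRel_adj, and_iff_right_iff_imp]
  rintro (hab | hab) rfl <;> exact (hG _ _ hab).false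

namespace IsPartialLayout

variable {S : Set V} {page : V → V → Fin 6} {col : V → Fin 6} {f : V → ℝ} {h : V → ℝ}

/-- The invariant speaks of all nonseparable subgraphs within `S`, not only of blocks, so that it
passes to larger sets. Such a subgraph is either old or lies in `K` together with `v`, where only
the pages `2` and `k` occur. -/
lemma block_extend (hL : G.IsPartialLayout S page col f) {K : Set V} {v : V} {k : Fin 6}
    {page' : V → V → Fin 6} (hKS : ∀ a ∈ S, a ≠ v → ∀ b ∈ K, ¬ G.toSimpleGraphInclusive.Adj a b)
    (hvK : v ∉ K) (hold : ∀ a ∈ S, ∀ b ∈ S, page' a b = page a b)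
    (hnew : ∀ a b, a ∈ K ∨ b ∈ K → page' a b = 2 ∨ page' a b = k)
    {B : G.toSimpleGraphInclusive.Subgraph} (hB : B.IsNonseparable) (hBS : B.verts ⊆ S ∪ K) :
    ∃ p q, ∀ a b, B.Adj a b → G.Adj a b → page' a b = p ∨ page' a b = q := by
  rcases hB.subset_or_subset hBS hKS hvK with hBS | hBK
  · obtain ⟨p, q, hpq⟩ := hL.block B hB hBS
    refine ⟨p, q, fun a b hab hG => ?_⟩
    rw [hold a (hBS (B.edge_vert hab)) b (hBS (B.edge_vert hab.symm))]
    exact hpq a b hab hG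
  · refine ⟨2, k, fun a b hab _ => hnew a b ?_⟩
    rcases hBK (B.edge_vert hab) with rfl | ha
    · rcases hBK (B.edge_vert hab.symm) with rfl | hb
      · exact absurd rfl (B.adj_sub hab).ne
      · exact Or.inr hb
    · exact Or.inl ha

lemma singleton (h : V → ℝ) (hG : ∀ a b, G.Adj a b → h a < h b) (v : V) :
    G.IsPartialLayout {v} (fun _ _ => 2) (fun _ => 0) h where
  layout := by
    refine ⟨Set.injOn_singleton _ _, fun a _ b _ => hG a b, ?_⟩
    rintro a rfl b rfl c rfl d rfl - - - hlt
    exact hlt.1.false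
  page_off _ _ _ := rfl
  col_free _ _ _ _ _ := by decide
  col_mem _ := Or.inl rfl
  attachment := by
    rintro a rfl a' rfl _ _ _ _ _
    rfl
  block _ _ _ := ⟨2, 2, fun _ _ _ _ => Or.inl rfl⟩

/-- The new edge takes the default page `2`, which is never a reserved page; this is why `page` and
`col` need no change. -/
lemma exists_insert [Finite V] (hL : G.IsPartialLayout S page col f)
    (hG : ∀ a b, G.Adj a b → h a < h b) {v u : V} (hv : v ∈ S) (hu : u ∉ S)
    (hvu : G.toSimpleGraphInclusive.Adj v u)
    (hone : ∀ u', G.toSimpleGraphInclusive.Adj v u' →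
      G.toSimpleGraphInclusive.JoinedOff S u u' → u' = u) :
    ∃ g, G.IsPartialLayout (insert u S) page col g := by
  have hadj {a b : V} := toSimpleGraphInclusive_adj_iff hG (a := a) (b := b)
  have hsep : ∀ a ∈ S, a ≠ v → ¬ G.toSimpleGraphInclusive.Adj a u := fun a ha hav hau =>
    hav (hL.attachment a ha v hv u u (.refl hu) hau hvu)
  have hP : IsPendantChain G.Adj S v [u] := by
    refine ⟨?_, ⟨by simp, by simp, trivial⟩, by simpa using hadj.1 hvu, by simp, by simpa using hu⟩
    intro a ha hav b hb
    rw [List.mem_singleton.1 hb, ← hadj]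
    exact hsep a ha hav
  obtain ⟨g, -, hg, -⟩ := hL.layout.exists_pendantChain
    (fun a b hab hba => (hG a b hab).asymm (hG b a hba)) [u] S.toFinite hv hP 1 one_pos
  have heq : S ∪ {x | x ∈ [u]} = insert u S := by
    ext x
    simp [or_comm]
  rw [heq] at hg
  refine ⟨g, hg, fun a b hab => hL.page_off a b fun hS =>
    hab ⟨Or.inr hS.1, Or.inr hS.2⟩, ?_, hL.col_mem, hL.attachment.insert hv hvu hu hone, ?_⟩
  · intro a ha b hb hab
    by_cases hS : a ∈ S ∧ b ∈ S
    · exact hL.col_free a hS.1 b hS.2 hab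
    · rw [hL.page_off a b hS]
      constructor
      · rcases hL.col_mem a with e | e <;> rw [e] <;> decide
      · rcases hL.col_mem b with e | e <;> rw [e] <;> decide
  · intro B hB hBS
    refine hL.block_extend (K := {u}) (v := v) (k := 2) ?_ hvu.ne (fun _ _ _ _ => rfl) ?_ hB
      (by rwa [Set.union_singleton])
    · rintro a ha hav b rfl
      exact hsep a ha hav
    · rintro a b hab
      refine Or.inl (hL.page_off a b fun hS => ?_)
      rcases hab with rfl | rfl
      · exact hu hS.1
      · exact hu hS.2

lemma isPendantChain_of_chordless (hG : ∀ a b, G.Adj a b → h a < h b) {v u x y : V}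
    {l : List V} (hsep : ∀ a ∈ S, a ≠ v → ∀ b ∈ l, ¬ G.toSimpleGraphInclusive.Adj a b)
    (hc : l.Chordless G.toSimpleGraphInclusive.Adj) (hl : l.IsChain G.toSimpleGraphInclusive.Adj)
    (hn : l.Nodup) (hlS : ∀ b ∈ l, b ∉ S) (hu : l.head? = some u) (hv : v ∈ S)
    (hvu : G.toSimpleGraphInclusive.Adj v u)
    (hvl : ∀ b ∈ l, G.toSimpleGraphInclusive.Adj v b → b = u) (hx : x ∉ S) (hy : y ∉ S)
    (hxy : ¬ (x ∈ l ∧ y ∈ l)) :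
    IsPendantChain (fun a b => G.Adj a b ∧ ¬ (a = x ∧ b = y)) S v l := by
  have hadj {a b : V} := toSimpleGraphInclusive_adj_iff hG (a := a) (b := b)
  have himp : ∀ a b, ((G.Adj a b ∧ ¬ (a = x ∧ b = y)) ∨ (G.Adj b a ∧ ¬ (b = x ∧ a = y))) →
      G.toSimpleGraphInclusive.Adj a b := fun a b hab => hadj.2 (hab.imp And.left And.left)
  refine ⟨fun a ha hav b hb hab => hsep a ha hav b hb (himp a b hab),
    ⟨fun b hb hab => by rw [hu, hvl b hb (himp v b hab)], hc.mono himp⟩, ?_, hn, hlS⟩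
  have hvx : v ≠ x := ne_of_mem_of_not_mem hv hx
  have hvy : v ≠ y := ne_of_mem_of_not_mem hv hy
  rw [List.isChain_cons]
  refine ⟨?_, ?_⟩
  · intro b hb
    rw [hu, Option.mem_some_iff] at hb
    subst hb
    exact (hadj.1 hvu).imp (⟨·, fun e => hvx e.1⟩) (⟨·, fun e => hvy e.2⟩)
  · refine hl.imp_of_mem_imp fun a b ha hb hab => ?_
    exact (hadj.1 hab).imp (⟨·, fun e => hxy ⟨e.1 ▸ ha, e.2 ▸ hb⟩⟩)
      (⟨·, fun e => hxy ⟨e.1 ▸ hb, e.2 ▸ ha⟩⟩)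

lemma exists_union_support [Finite V] (hL : G.IsPartialLayout S page col f)
    (hH : G.toSimpleGraphInclusive.IsCactus) (hG : ∀ a b, G.Adj a b → h a < h b) {v u u' x y : V}
    (hv : v ∈ S) {p : G.toSimpleGraphInclusive.Walk u u'} (hp : p.IsPath)
    (hpS : ∀ x ∈ p.support, x ∉ S) (hu : G.toSimpleGraphInclusive.Adj v u)
    (hu' : G.toSimpleGraphInclusive.Adj v u') (hne : u' ≠ u) {l₁ l₂ : List V}
    (hsplit : p.support = l₁ ++ x :: y :: l₂) (hxy : G.Adj x y)
    (hside : G.Adj u v ∨ G.Adj v u') :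
    ∃ page' col' g, G.IsPartialLayout (S ∪ {x | x ∈ p.support}) page' col' g := by
  classical
  have hadj {a b : V} := toSimpleGraphInclusive_adj_iff hG (a := a) (b := b)
  have hasymm : ∀ a b, G.Adj a b → ¬ G.Adj b a := fun a b hab hba =>
    (hG a b hab).asymm (hG b a hba)
  have hvp : v ∉ p.support := fun hm => hpS v hm hv
  set X := l₁ ++ [x] with hX
  set Y := (y :: l₂).reverse with hY
  have hsX : p.support = X ++ y :: l₂ := by simp [hsplit, hX]
  have hsY : p.reverse.support = Y ++ X.reverse := by
    rw [SimpleGraph.Walk.support_reverse, hsX, List.reverse_append]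
  have hnd := hp.support_nodup
  rw [hsX, List.nodup_append'] at hnd
  obtain ⟨hndX, hndY, hdisj⟩ := hnd
  have hmem : ∀ a, a ∈ p.support ↔ a ∈ X ∨ a ∈ Y := fun a => by
    rw [hsX, List.mem_append, hY, List.mem_reverse]
  have hXp : ∀ a ∈ X, a ∈ p.support := fun a ha => (hmem a).2 (Or.inl ha)
  have hYp : ∀ a ∈ Y, a ∈ p.support := fun a ha => (hmem a).2 (Or.inr ha)
  have hXY : ∀ a ∈ X, a ∉ Y := fun a ha ha' => hdisj ha (List.mem_reverse.1 ha')
  have hxX : x ∈ X := by simp [hX]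
  have hyY : y ∈ Y := by simp [hY]
  have hcp := hH.chordless_support hp hvp hu hu'
  have hcr := hH.chordless_support hp.reverse (by simpa using hvp) hu' hu
  have hheadX : X.head? = some u := by
    have e : p.support.head? = some u := by cases p <;> rfl
    rw [hsX, List.head?_append_of_ne_nil _ (by simp [hX])] at e
    exact e
  have hheadY : Y.head? = some u' := by
    have e : p.reverse.support.head? = some u' := by cases p.reverse <;> rfl
    rw [hsY, List.head?_append_of_ne_nil _ (by simp [hY])] at e
    exact e
  have huX : u ∈ X := List.mem_of_head? hheadX
  have huY : u' ∈ Y := List.mem_of_head? hheadY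
  have hends : ∀ b ∈ p.support, G.toSimpleGraphInclusive.Adj v b → b = u ∨ b = u' := by
    intro b hb hvb
    by_contra! hcon
    have hoff : ∀ z ∈ p.support, z ∉ ({v} : Set V) := fun z hz e => hvp (e ▸ hz)
    exact hH.not_three_neighbors hu hu' hvb hne hcon.1 hcon.2.symm
      (.of_mem_support hoff p.start_mem_support p.end_mem_support)
      (.of_mem_support hoff p.start_mem_support hb)
  have hsep : ∀ a ∈ S, a ≠ v → ∀ b ∈ p.support, ¬ G.toSimpleGraphInclusive.Adj a b :=
    fun a ha hav b hb hab => hav (hL.attachment a ha v hv b u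
      (.of_mem_support hpS hb p.start_mem_support) hab hu)
  have hchX : IsPendantChain (fun a b => G.Adj a b ∧ ¬ (a = x ∧ b = y)) S v X := by
    refine isPendantChain_of_chordless hG (fun a ha hav b hb => hsep a ha hav b (hXp b hb))
      ?_ ?_ hndX (fun b hb => hpS b (hXp b hb)) hheadX hv hu ?_
      (hpS x (hXp x hxX)) (hpS y (hYp y hyY)) fun e => hXY y e.2 hyY
    · rw [hsX] at hcp
      exact hcp.left_of_append hdisj
    · have := p.isChain_adj_support
      rw [hsX] at this
      exact this.left_of_append
    · intro b hb hvb
      refine (hends b (hXp b hb) hvb).resolve_right ?_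
      rintro rfl
      exact hXY b hb huY
  have hchY : IsPendantChain (fun a b => G.Adj a b ∧ ¬ (a = x ∧ b = y)) S v Y := by
    refine isPendantChain_of_chordless hG (fun a ha hav b hb => hsep a ha hav b (hYp b hb))
      ?_ ?_ (List.nodup_reverse.2 hndY) (fun b hb => hpS b (hYp b hb)) hheadY hv hu' ?_
      (hpS x (hXp x hxX)) (hpS y (hYp y hyY)) fun e => hXY x hxX e.1
    · rw [hsY] at hcr
      exact hcr.left_of_append
        fun a ha ha' => hXY a (List.mem_reverse.1 ha') ha
    · have := p.reverse.isChain_adj_support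
      rw [hsY] at this
      exact this.left_of_append
    · intro b hb hvb
      refine (hends b (hYp b hb) hvb).resolve_left ?_
      rintro rfl
      exact hXY b huX hb
  have hcross : ∀ a ∈ X, ∀ b ∈ Y, G.toSimpleGraphInclusive.Adj a b → a = x ∧ b = y := by
    intro a ha b hb hab
    rw [hsplit] at hcp
    exact hcp.eq_of_append hdisj ha (List.mem_reverse.1 hb) hab
  have hk2 : col v ≠ 2 := by rcases hL.col_mem v with e | e <;> rw [e] <;> decide
  -- Only `x → y` leaves page `2`. It takes the page reserved at `v`, so the path vertices must
  -- reserve the other one, `1 - col v`.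
  set page' : V → V → Fin 6 := fun a b => if a = x ∧ b = y then col v else page a b with hpage'
  set col' : V → Fin 6 := fun a => if a ∈ p.support then 1 - col v else col a with hcol'
  have hp_new : page' x y = col v := by simp [hpage']
  have hp_old : ∀ a b, ¬ (a = x ∧ b = y) → page' a b = page a b := fun a b e => by
    simp only [hpage', if_neg e]
  have hp_S : ∀ a ∈ S, ∀ b ∈ S, page' a b = page a b := fun a ha b _ =>
    hp_old a b fun e => hpS x (hXp x hxX) (e.1 ▸ ha)
  have hcol_mem : ∀ a, col' a = 0 ∨ col' a = 1 := by
    intro a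
    simp only [hcol']
    split_ifs
    · rcases hL.col_mem v with e | e <;> rw [e] <;> decide
    · exact hL.col_mem a
  have hset : S ∪ {a | a ∈ p.support} = S ∪ {a | a ∈ X} ∪ {a | a ∈ Y} := by
    ext a
    simp only [Set.mem_union, Set.mem_ofPred_eq, hmem, or_assoc]
  have hlay : IsLayout G.Adj page' S f :=
    hL.layout.congr (fun a ha b hb hab => ⟨hab, hp_S a ha b hb⟩) fun _ _ => rfl
  obtain ⟨g, hg⟩ := hlay.exists_cycle hasymm S.toFinite hv hxX hyY hchX hchY
    (by
      rintro a ha b hb (⟨hab, hn⟩ | ⟨hba, -⟩)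
      · exact hn (hcross a ha b hb (hadj.2 (Or.inl hab)))
      · obtain ⟨rfl, rfl⟩ := hcross a ha b hb (hadj.2 (Or.inr hba))
        exact hasymm _ _ hxy hba)
    hXY (hside.imp (fun e => ⟨u, hheadX, e⟩) fun e => ⟨u', hheadY, e⟩)
    (by
      intro a _ b _ hab hpg
      by_cases e : a = x ∧ b = y
      · exact Or.inl e
      rw [hp_new, hp_old a b e] at hpg
      -- An old edge on page `col v` cannot end at `v`, and the other new edges are on page `2 ≠ col
      -- v`.
      by_cases hS : a ∈ S ∧ b ∈ S
      · have := hL.col_free a hS.1 b hS.2 hab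
        refine Or.inr ⟨hS.1, ?_, hS.2, ?_⟩
        · rintro rfl; exact this.1 hpg
        · rintro rfl; exact this.2 hpg
      · exact absurd (hpg.symm.trans (hL.page_off a b hS)) hk2)
  rw [← hset] at hg
  refine ⟨page', col', g, hg, ?_, ?_, hcol_mem,
    hL.attachment.union_support hH hv hp hpS hu hu' hne, ?_⟩
  · intro a b hab
    rw [hp_old]
    · exact hL.page_off a b fun hS => hab ⟨Or.inl hS.1, Or.inl hS.2⟩
    · rintro ⟨rfl, rfl⟩
      exact hab ⟨Or.inr (hXp _ hxX), Or.inr (hYp _ hyY)⟩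
  · intro a _ b _ hab
    by_cases e : a = x ∧ b = y
    · obtain ⟨rfl, rfl⟩ := e
      have hk : col v ≠ 1 - col v := by rcases hL.col_mem v with e | e <;> rw [e] <;> decide
      rw [hp_new]
      simp only [hcol', if_pos (hXp _ hxX), if_pos (hYp _ hyY)]
      exact ⟨hk, hk⟩
    · rw [hp_old a b e]
      by_cases hS : a ∈ S ∧ b ∈ S
      · simp only [hcol', if_neg fun hm => hpS a hm hS.1, if_neg fun hm => hpS b hm hS.2]
        exact hL.col_free a hS.1 b hS.2 hab
      · rw [hL.page_off a b hS]
        constructor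
        · rcases hcol_mem a with e | e <;> rw [e] <;> decide
        · rcases hcol_mem b with e | e <;> rw [e] <;> decide
  · intro B hB hBS
    refine hL.block_extend (K := {a | a ∈ p.support}) (v := v) (k := col v) hsep hvp hp_S ?_ hB hBS
    intro a b hab
    by_cases e : a = x ∧ b = y
    · exact Or.inr (by rw [e.1, e.2, hp_new])
    · rw [hp_old a b e]
      refine Or.inl (hL.page_off a b fun hS => ?_)
      rcases hab with ha | hb
      · exact hpS a ha hS.1
      · exact hpS b hb hS.2

lemma exists_ssuperset [Finite V] (hL : G.IsPartialLayout S page col f)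
    (hH : G.toSimpleGraphInclusive.IsCactus) (hG : ∀ a b, G.Adj a b → h a < h b)
    (hne : S.Nonempty) (huniv : S ≠ Set.univ) :
    ∃ T, S ⊂ T ∧ ∃ page' col' g, G.IsPartialLayout T page' col' g := by
  classical
  obtain ⟨v₀, hv₀⟩ := hne
  obtain ⟨u₀, hu₀⟩ := (Set.ne_univ_iff_exists_notMem S).1 huniv
  obtain ⟨q⟩ := hH.1.preconnected v₀ u₀
  obtain ⟨d, -, hv, hu⟩ := q.exists_boundary_dart S hv₀ hu₀
  obtain ⟨⟨v, u⟩, hvu⟩ := d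
  dsimp only at hv hu hvu
  by_cases hone : ∀ u', G.toSimpleGraphInclusive.Adj v u' →
      G.toSimpleGraphInclusive.JoinedOff S u u' → u' = u
  · obtain ⟨g, hg⟩ := hL.exists_insert hG hv hu hvu hone
    exact ⟨_, Set.ssubset_insert hu, page, col, g, hg⟩
  · push Not at hone
    obtain ⟨u', hvu', ⟨w, hw⟩, hne⟩ := hone
    have hadj {a b : V} := toSimpleGraphInclusive_adj_iff hG (a := a) (b := b)
    set p := w.bypass with hpw
    have hp : p.IsPath := w.bypass_isPath
    have hpS : ∀ x ∈ p.support, x ∉ S := fun x hx => hw x (w.support_bypass_subset_support hx)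
    refine ⟨S ∪ {x | x ∈ p.support}, ?_, ?_⟩
    · exact (Set.ssubset_iff_of_subset Set.subset_union_left).2
        ⟨u, Or.inr p.start_mem_support, hu⟩
    have hhead : p.support.head? = some u := by cases p <;> rfl
    have hlast : p.support.getLast? = some u' := by
      rw [List.getLast?_eq_some_getLast p.support_ne_nil, p.getLast_support]
    obtain ⟨l₁, x, y, l₂, e, ⟨hxy, hs⟩ | ⟨hyx, hs⟩⟩ := List.IsChain.exists_split hG
      (p.isChain_adj_support.imp fun _ _ => hadj.1) hhead hlast hne.symm (hadj.1 hvu)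
      (hadj.1 hvu')
    · exact hL.exists_union_support hH hG hv hp hpS hvu hvu' hne e hxy hs
    -- The suitable edge points backwards along `p`, so the path is traversed from `u'` to `u`.
    · have := hL.exists_union_support hH hG hv hp.reverse (by simpa using hpS) hvu' hvu hne.symm
        (l₁ := l₂.reverse) (l₂ := l₁.reverse) (x := y) (y := x)
        (by simp [SimpleGraph.Walk.support_reverse, e]) hyx hs
      simpa using this

end IsPartialLayout

end Digraph

/-! ### The book embedding from a maximal partial layout -/

theorem theorem3 {V : Type*} [Fintype V] (G : Digraph V)
    (hcactus : G.toSimpleGraphInclusive.IsCactus) (hG : G.IsUpwardOuterplanar) :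
    ∃ B : G.UpwardBookEmbedding 6,
      ∀ H : G.toSimpleGraphInclusive.Subgraph, H.IsBlock →
        ∃ p q : Fin 6, ∀ e : G.Edge, H.Adj e.tail e.head → B.page e = p ∨ B.page e = q := by
  classical
  obtain ⟨D, -, hup⟩ := hG
  have hheight : ∀ a b, G.Adj a b → (D.pos a).2 < (D.pos b).2 := by
    intro a b hab
    have := hup ⟨(a, b), hab⟩ (show (0 : unitInterval) < 1 from zero_lt_one)
    simpa using this
  obtain ⟨v₀⟩ := hcactus.1.nonempty
  obtain ⟨S, hS, hmax⟩ := (Set.toFinite {S : Set V | S.Nonempty ∧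
    ∃ page col f, G.IsPartialLayout S page col f}).exists_maximal
      ⟨{v₀}, Set.singleton_nonempty v₀, _, _, _, .singleton _ hheight v₀⟩
  obtain ⟨hne, page, col, f, hL⟩ := hS
  have huniv : S = Set.univ := by
    by_contra hcon
    obtain ⟨T, hST, hT⟩ := hL.exists_ssuperset hcactus hheight hne hcon
    exact hST.2 (hmax ⟨hne.mono hST.1, hT⟩ hST.1)
  subst huniv
  have hinj : Function.Injective f := Set.injOn_univ.1 hL.layout.injOn
  -- Real positions are turned into ranks by ordering the vertices according to `f`.
  let _ : LinearOrder V := LinearOrder.lift' f hinj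
  let φ : Fin (Fintype.card V) ≃o V := Fintype.orderIsoFinOfCardEq V rfl
  have hφ : ∀ a b : V, φ.symm a < φ.symm b ↔ f a < f b := fun a b => φ.symm.lt_iff_lt
  refine ⟨⟨φ.symm.toEquiv, fun e => page e.tail e.head, fun e => ?_, fun e e' he hcross => ?_⟩,
    fun H hH => ?_⟩
  · exact (hφ _ _).2 (hL.layout.lt _ trivial _ trivial e.2)
  · exact hL.layout.not_cross _ trivial _ trivial _ trivial _ trivial e.2 e'.2 he
      ⟨(hφ _ _).1 hcross.1, (hφ _ _).1 hcross.2.1, (hφ _ _).1 hcross.2.2⟩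
  · obtain ⟨p, q, hpq⟩ := hL.block H hH.prop (Set.subset_univ _)
    exact ⟨p, q, fun e he => hpq _ _ he e.2⟩
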